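/- Theorem (unisolvence for polynomial 1-forms on the pentatope). For integers $m$, let $P^{m}$ be the space of real polynomials of total degree at most $m$ (in the variables indicated by the context, with $P^m=\{0\}$ for $m<0$), and let $\tilde P^{m}$ be the space of homogeneous polynomials of degree $m$. Let $K\subset\mathbb{R}^4$ be a non-degenerate pentatope, i.e. the convex hull of five affinely independent points (for example the pentatope with vertices $0,e_1,e_2,e_3,e_4$, or the reference pentatope $\mathfrak{T}^4=\{x\in[-1,1]^4: x_1+x_2+x_3+x_4\le -2\}$). For an integer $k\ge 0$ put $$V^{k,1}(K)=(P^{k-1})^4\oplus\{p\in(\tilde P^{k})^4 : p\cdot x=0\},$$ where $p$ and $x=(x_1,x_2,x_3,x_4)$ are 4-vectors of polynomials in $x_1,\dots,x_4$. For a face $f$ of $K$ let $\mathrm{Tr}(E)$ be the tangential component of $E$ on $f$. The degrees of freedom $\Sigma^{k,1}(K)$ of $E\in V^{k,1}(K)$ are the moments * $\int_e (\mathrm{Tr}(E)\cdot\tau)\,q\,ds$ for each of the 10 edges $e$ of $K$, with unit tangent $\tau$, and each $q\in P^{k-1}(e)$; * $\int_f \mathrm{Tr}(E)\cdot q\,dA$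 for each of the 10 triangular faces $f$ and each tangential field $q$ on $f$ with components in $P^{k-2}(f)$; * $\int_{\mathcal F}\mathrm{Tr}(E)\cdot q\,dV$ for each of the 5 tetrahedral facets $\mathcal F$ and each tangential field $q$ on $\mathcal F$ with components in $P^{k-3}(\mathcal F)$; * $\int_K E\cdot q\,dx$ for each $q\in (P^{k-4})^4$. If $E\in V^{k,1}(K)$ and all the degrees of freedom $\Sigma^{k,1}(K)$ of $E$ vanish, then $E\equiv 0$. Moreover the degrees of freedom are unisolvent: for every choice of linear functionals on the test spaces above, one for each edge, each triangular face, each tetrahedral facet, and one for $K$, there is exactly one $E\in V^{k,1}(K)$ whose moments are given by these functionals. -/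

import Mathlib

open scoped InnerProductSpace

noncomputable section

/-- Euclidean space `ℝ⁴`. -/
abbrev R4 : Type := EuclideanSpace ℝ (Fin 4)

/-- `P^m`: the real polynomials in `n` variables of total degree at most `m`. The degree bound is an
integer, and for `m < 0` this is the zero space. -/
def polyLE (n : ℕ) (m : ℤ) : Submodule ℝ (MvPolynomial (Fin n) ℝ) :=
  MvPolynomial.restrictSupport ℝ {α : Fin n →₀ ℕ | (α.degree : ℤ) ≤ m}

/-- Polynomial 1-forms on `ℝ⁴`, through their proxies: 4-vectors of polynomials in `x₁, …, x₄`. -/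
abbrev PolyForm : Type := Fin 4 → MvPolynomial (Fin 4) ℝ

/-- The value at the point `x` of the vector field given by a polynomial 1-form. -/
def PolyForm.val (E : PolyForm) (x : R4) : R4 :=
  WithLp.toLp 2 fun i => MvPolynomial.eval (fun j => x j) (E i)

/-- `(P^m)⁴`. -/
def fullPart (m : ℤ) : Submodule ℝ PolyForm :=
  Submodule.pi Set.univ fun _ => polyLE 4 m

/-- `{p ∈ (P̃^k)⁴ : p · x = 0}`, where `P̃^k` are the homogeneous polynomials of degree `k`. -/
def homPart (k : ℕ) : Submodule ℝ PolyForm where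
  carrier := {p | (∀ i, (p i).IsHomogeneous k) ∧ ∑ i, p i * MvPolynomial.X i = 0}
  add_mem' := by
    rintro p q ⟨hp, hp'⟩ ⟨hq, hq'⟩
    exact ⟨fun i => (hp i).add (hq i), by
      simp only [Pi.add_apply, add_mul, Finset.sum_add_distrib, hp', hq', add_zero]⟩
  zero_mem' := ⟨fun _ => MvPolynomial.isHomogeneous_zero _ _ _, by simp⟩
  smul_mem' := by
    rintro c p ⟨hp, hp'⟩
    refine ⟨fun i => (MvPolynomial.homogeneousSubmodule (Fin 4) ℝ k).smul_mem c (hp i), ?_⟩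
    simp only [Pi.smul_apply, smul_mul_assoc, ← Finset.smul_sum, hp', smul_zero]

/-- The space of shape functions `V^{k,1} = (P^{k-1})⁴ ⊕ {p ∈ (P̃^k)⁴ : p · x = 0}`. -/
def V1 (k : ℕ) : Submodule ℝ PolyForm :=
  fullPart ((k : ℤ) - 1) ⊔ homPart k

/-- The sum defining `V1` is direct. -/
theorem disjoint_fullPart_homPart (k : ℕ) : Disjoint (fullPart ((k : ℤ) - 1)) (homPart k) := by
  rw [Submodule.disjoint_def]
  intro p hp hq
  funext i
  ext α
  by_contra h
  have h1 : α.degree = k := by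
    have := hq.1 i h
    rw [Finsupp.degree_eq_weight_one]
    exact this
  have h2 : (α.degree : ℤ) ≤ (k : ℤ) - 1 := by
    have := (MvPolynomial.mem_restrictSupport_iff ℝ).1 (hp i (Set.mem_univ i))
    exact this (MvPolynomial.mem_support_iff.2 h)
  omega

section Faces

variable {d : ℕ} (w : Fin (d + 1) → R4)

/-- The edge vectors `w₁ - w₀, …, w_d - w₀` of the `d`-simplex with vertices `w₀, …, w_d`. -/
def edgeVec (i : Fin d) : R4 := w i.succ - w 0

/-- The corner simplex `{t ∈ ℝ^d : tᵢ ≥ 0, ∑ tᵢ ≤ 1}`. -/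
def corner (d : ℕ) : Set (Fin d → ℝ) := {t | (∀ i, 0 ≤ t i) ∧ ∑ i, t i ≤ 1}

/-- The affine parametrization of the simplex with vertices `w₀, …, w_d` by the corner simplex. -/
def param (t : Fin d → ℝ) : R4 := w 0 + ∑ i, t i • edgeVec w i

/-- The integral, with respect to the `d`-dimensional surface measure, over the simplex `f` with
vertices `w₀, …, w_d` of a function `g` written in the affine coordinates `t` of `f`; the surface
element is `√(det Gram) dt`. -/
def faceIntegral (g : (Fin d → ℝ) → ℝ) : ℝ :=
  √(Matrix.gram ℝ (edgeVec w)).det * ∫ t in corner d, g t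

/-- The trace `Tr[f](E)` of a 1-form on the simplex `f` at a point: the tangential component
of `E`, a vector in the tangent space of `f`. -/
def faceTrace (E : PolyForm) (x : R4) : vectorSpan ℝ (Set.range w) :=
  (vectorSpan ℝ (Set.range w)).orthogonalProjectionOnto (E.val x)

/-- The tangential vector field `∑ qᵢ (wᵢ - w₀)` on the simplex `f`. If the `qᵢ` run through
`P^m(f)` (polynomials of degree at most `m` in the affine coordinates of `f`), these are the fields
in `(P^m(f))^d` tangent to `f`. -/
def tangentField (q : Fin d → MvPolynomial (Fin d) ℝ) (t : Fin d → ℝ) : R4 :=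
  ∑ i, MvPolynomial.eval t (q i) • edgeVec w i

/-- The moment `∫_f Tr(E) · q` of a 1-form against a tangential polynomial field on `f`.
On a triangle with unit normal `ν` in a facet this is `∫_f (Tr(E) × ν) · (q × ν)`, as `q · ν = 0`. -/
def faceMoment (E : PolyForm) (q : Fin d → MvPolynomial (Fin d) ℝ) : ℝ :=
  faceIntegral w fun t => ⟪(faceTrace w E (param w t) : R4), tangentField w q t⟫_ℝ

end Faces

/-- The unit tangent vector `τ` of the edge from `w₀` to `w₁`. -/
def unitTangent (w : Fin 2 → R4) : R4 := ‖w 1 - w 0‖⁻¹ • (w 1 - w 0)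

/-- The moment `∫_e (Tr(E) · τ) q` on an edge `e`. -/
def edgeMoment (w : Fin 2 → R4) (E : PolyForm) (q : MvPolynomial (Fin 1) ℝ) : ℝ :=
  faceIntegral w fun t =>
    ⟪(faceTrace w E (param w t) : R4), unitTangent w⟫_ℝ * MvPolynomial.eval t q

/-- The moment `∫_K E · q dx` over the pentatope `K` with vertices `v`. -/
def volumeMoment (v : Fin 5 → R4) (E q : PolyForm) : ℝ :=
  ∫ x in convexHull ℝ (Set.range v), ⟪E.val x, q.val x⟫_ℝ

/-- `d`-dimensional faces of a pentatope: increasing choices of `d + 1` of its five vertices. -/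
abbrev FaceIdx (d : ℕ) : Type := Fin (d + 1) ↪o Fin 5

/-- Values for the degrees of freedom `Σ^{k,1}(K)`: for each edge, triangular face, tetrahedral
facet and for the volume, a linear functional on the space of test polynomials of that moment. -/
structure DofValues (k : ℕ) where
  edge : FaceIdx 1 → Module.Dual ℝ (polyLE 1 ((k : ℤ) - 1))
  face : FaceIdx 2 → Module.Dual ℝ (Fin 2 → polyLE 2 ((k : ℤ) - 2))
  facet : FaceIdx 3 → Module.Dual ℝ (Fin 3 → polyLE 3 ((k : ℤ) - 3))
  volume : Module.Dual ℝ (Fin 4 → polyLE 4 ((k : ℤ) - 4))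

/-- The degrees of freedom `Σ^{k,1}(K)` of `E` on the pentatope `K` with vertices `v` take the
values `b`. -/
structure HasDofs (v : Fin 5 → R4) (k : ℕ) (E : PolyForm) (b : DofValues k) : Prop where
  edge : ∀ (e : FaceIdx 1) (q : polyLE 1 ((k : ℤ) - 1)), edgeMoment (v ∘ e) E q = b.edge e q
  face : ∀ (f : FaceIdx 2) (q : Fin 2 → polyLE 2 ((k : ℤ) - 2)),
    faceMoment (v ∘ f) E (fun i => q i) = b.face f q
  facet : ∀ (f : FaceIdx 3) (q : Fin 3 → polyLE 3 ((k : ℤ) - 3)),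
    faceMoment (v ∘ f) E (fun i => q i) = b.facet f q
  volume : ∀ q : Fin 4 → polyLE 4 ((k : ℤ) - 4),
    volumeMoment v E (fun i => q i) = b.volume q

/-- All the degrees of freedom `Σ^{k,1}(K)` of `E` vanish. -/
structure DofsVanish (v : Fin 5 → R4) (k : ℕ) (E : PolyForm) : Prop where
  edge : ∀ (e : FaceIdx 1) (q : polyLE 1 ((k : ℤ) - 1)), edgeMoment (v ∘ e) E q = 0
  face : ∀ (f : FaceIdx 2) (q : Fin 2 → polyLE 2 ((k : ℤ) - 2)),
    faceMoment (v ∘ f) E (fun i => q i) = 0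
  facet : ∀ (f : FaceIdx 3) (q : Fin 3 → polyLE 3 ((k : ℤ) - 3)),
    faceMoment (v ∘ f) E (fun i => q i) = 0
  volume : ∀ q : Fin 4 → polyLE 4 ((k : ℤ) - 4), volumeMoment v E (fun i => q i) = 0

end

open MvPolynomial

/-! The space `V1 k` consists of the 1-forms `u` with coefficients in P^k and `u · x` in P^k
(`V1_eq_nedelec`). In this form it is defined in every dimension and is preserved by affine pullback
(`pull_mem_nedelec`). Each face can therefore be pulled back to the corner simplex, where a face
moment becomes, up to a nonzero factor, the integral of `∑ uᵢ qᵢ`.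

Injectivity goes by the dimension of the face. On an edge, `u · x ∈ P^k` forces `u ∈ P^{k-1}`, so
`u` can be tested against itself. Let now n ≥ 2, let λ₀ = 1 - ∑ xᵢ, and suppose that the traces on
all facets of the n-simplex vanish. Divisibility by the xᵢ and λ₀ (`exists_bubble_form`) then gives
u_j = (∏ xᵢ) ∑ Rᵢ + λ₀ (∏_{i≠j} xᵢ) R_j with R_j ∈ P^{k-n}. Hence `R` is an admissible test field,
and ∑ u_j R_j = (∏ xᵢ)(∑ Rᵢ)² + ∑ λ₀ (∏_{i≠j} xᵢ) R_j² is nonnegative on the simplex. Its integral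
is zero, so every R_j vanishes, and with it `u`.

Surjectivity is a dimension count. Contraction with `x` modulo P^k bounds dim `V1 k` below by 5 dim
P^k - dim P^{k+1}, which equals the number of degrees of freedom; injectivity gives the opposite
inequality. -/

/-! ### Polynomials of bounded degree. -/

theorem mem_polyLE {n : ℕ} {m : ℤ} {p : MvPolynomial (Fin n) ℝ} :
    p ∈ polyLE n m ↔ ∀ α ∈ (p.support : Set (Fin n →₀ ℕ)), (α.degree : ℤ) ≤ m :=
  Iff.rfl

theorem mem_polyLE_iff_totalDegree {n : ℕ} {m : ℤ} {p : MvPolynomial (Fin n) ℝ} (hp : p ≠ 0) :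
    p ∈ polyLE n m ↔ (p.totalDegree : ℤ) ≤ m := by
  rw [mem_polyLE]
  constructor
  · intro h
    obtain ⟨α, hα, h1⟩ := Finset.exists_mem_eq_sup p.support
      (support_nonempty.2 hp) (fun s => s.sum fun _ e => e)
    have := h α hα
    rw [MvPolynomial.totalDegree, h1]
    exact this
  · intro h α hα
    have := le_totalDegree hα
    have h2 : (α.degree : ℤ) ≤ p.totalDegree := Int.ofNat_le.2 this
    exact h2.trans h

theorem mem_polyLE_natCast {n m : ℕ} {p : MvPolynomial (Fin n) ℝ} :
    p ∈ polyLE n (m : ℤ) ↔ p.totalDegree ≤ m := by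
  by_cases hp : p = 0
  · simp [hp]
  · rw [mem_polyLE_iff_totalDegree hp]; norm_cast

theorem polyLE_mono {n : ℕ} {a b : ℤ} (h : a ≤ b) : polyLE n a ≤ polyLE n b :=
  fun _ hp _ hα => le_trans (hp hα) h

theorem mul_mem_polyLE {n : ℕ} {a b : ℤ} {p q : MvPolynomial (Fin n) ℝ} (hp : p ∈ polyLE n a)
    (hq : q ∈ polyLE n b) : p * q ∈ polyLE n (a + b) := by
  by_cases hp0 : p = 0
  · simp [hp0]
  by_cases hq0 : q = 0
  · simp [hq0]
  rw [mem_polyLE_iff_totalDegree hp0] at hp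
  rw [mem_polyLE_iff_totalDegree hq0] at hq
  rw [mem_polyLE_iff_totalDegree (mul_ne_zero hp0 hq0), totalDegree_mul_of_isDomain hp0 hq0]
  push_cast
  linarith

/-- Degrees add over a domain. Every degree drop below comes from here; a negative resulting bound
forces `q = 0`. -/
theorem mem_polyLE_of_mul_mem {n : ℕ} {m : ℤ} {p q : MvPolynomial (Fin n) ℝ} (hp : p ≠ 0)
    (h : p * q ∈ polyLE n m) : q ∈ polyLE n (m - p.totalDegree) := by
  by_cases hq0 : q = 0
  · simp [hq0]
  rw [mem_polyLE_iff_totalDegree (mul_ne_zero hp hq0), totalDegree_mul_of_isDomain hp hq0] at h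
  rw [mem_polyLE_iff_totalDegree hq0]
  push_cast at h
  linarith

theorem C_mem_polyLE (n : ℕ) (c : ℝ) : C c ∈ polyLE n 0 :=
  mem_polyLE_natCast.2 (totalDegree_C c).le

theorem X_mem_polyLE {n : ℕ} (i : Fin n) : X i ∈ polyLE n 1 :=
  mem_polyLE_natCast.2 (totalDegree_X i).le

theorem prod_pow_mem_polyLE {N d : ℕ} {s : Fin N → MvPolynomial (Fin d) ℝ}
    (hs : ∀ i, s i ∈ polyLE d 1) (α : Fin N →₀ ℕ) :
    ∏ i, s i ^ α i ∈ polyLE d (α.degree : ℤ) := by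
  rw [mem_polyLE_natCast]
  refine (totalDegree_finsetProd _ _).trans ?_
  rw [Finsupp.degree_eq_sum]
  refine Finset.sum_le_sum fun i _ => (totalDegree_pow _ _).trans ?_
  have : (s i).totalDegree ≤ 1 := mem_polyLE_natCast.1 (hs i)
  nlinarith

theorem aeval_mem_polyLE {N d : ℕ} {m : ℤ} {s : Fin N → MvPolynomial (Fin d) ℝ}
    (hs : ∀ i, s i ∈ polyLE d 1) {p : MvPolynomial (Fin N) ℝ} (hp : p ∈ polyLE N m) :
    aeval s p ∈ polyLE d m := by
  rw [aeval_def, eval₂_eq']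
  refine Submodule.sum_mem _ fun α hα => ?_
  rw [← Algebra.smul_def]
  exact Submodule.smul_mem _ _ (polyLE_mono (hp hα) (prod_pow_mem_polyLE hs α))

theorem rename_mem_polyLE {N d : ℕ} {m : ℤ} (f : Fin N → Fin d) {p : MvPolynomial (Fin N) ℝ}
    (hp : p ∈ polyLE N m) : rename f p ∈ polyLE d m := by
  rw [rename_eq_aeval]
  exact aeval_mem_polyLE (fun i => X_mem_polyLE _) hp

/-- The polynomial 1-forms `u` in `n` variables with coefficients in `P^k` and `u · x ∈ P^k`. -/
noncomputable def nedelec (n : ℕ) (k : ℤ) : Submodule ℝ (Fin n → MvPolynomial (Fin n) ℝ) where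
  carrier := {u | (∀ i, u i ∈ polyLE n k) ∧ ∑ i, u i * X i ∈ polyLE n k}
  add_mem' := by
    rintro u v ⟨hu, hu'⟩ ⟨hv, hv'⟩
    exact ⟨fun i => add_mem (hu i) (hv i), by
      simpa only [Pi.add_apply, add_mul, Finset.sum_add_distrib] using add_mem hu' hv'⟩
  zero_mem' := ⟨fun _ => zero_mem _, by simp⟩
  smul_mem' := by
    rintro c u ⟨hu, hu'⟩
    exact ⟨fun i => Submodule.smul_mem _ c (hu i), by
      simpa only [Pi.smul_apply, smul_mul_assoc, ← Finset.smul_sum] using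
        Submodule.smul_mem _ c hu'⟩

/-! ### Divisibility by facet equations and the form of bubbles. -/

/-- Algebra maps out of a polynomial ring that agree on the variables modulo an ideal agree modulo
that ideal. -/
theorem algHom_sub_mem {σ A : Type*} [CommRing A] [Algebra ℝ A] (I : Ideal A)
    (f g : MvPolynomial σ ℝ →ₐ[ℝ] A) (h : ∀ i, f (X i) - g (X i) ∈ I) (p : MvPolynomial σ ℝ) :
    f p - g p ∈ I := by
  have : (Ideal.Quotient.mkₐ ℝ I).comp f = (Ideal.Quotient.mkₐ ℝ I).comp g :=
    algHom_ext fun i => Ideal.Quotient.eq.2 (h i)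
  exact Ideal.Quotient.eq.1 (DFunLike.congr_fun this p)

/-- The substitution `X m ↦ s`, in which the other variables are renumbered. -/
noncomputable def substVar {n : ℕ} (m : Fin (n + 1)) (s : MvPolynomial (Fin n) ℝ) :
    MvPolynomial (Fin (n + 1)) ℝ →ₐ[ℝ] MvPolynomial (Fin n) ℝ :=
  aeval (m.insertNth (α := fun _ => MvPolynomial (Fin n) ℝ) s X)

@[simp] theorem substVar_X_same {n : ℕ} (m : Fin (n + 1)) (s : MvPolynomial (Fin n) ℝ) :
    substVar m s (X m) = s := by
  simp [substVar]

@[simp] theorem substVar_X_succAbove {n : ℕ} (m : Fin (n + 1)) (s : MvPolynomial (Fin n) ℝ)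
    (j : Fin n) : substVar m s (X (m.succAbove j)) = X j := by
  simp [substVar]

/-- Modulo `X m - s`, substituting and renaming back fixes every variable, hence every polynomial.
-/
theorem dvd_of_substVar_eq_zero {n : ℕ} (m : Fin (n + 1)) (s : MvPolynomial (Fin n) ℝ)
    {p : MvPolynomial (Fin (n + 1)) ℝ} (h : substVar m s p = 0) :
    X m - rename m.succAbove s ∣ p := by
  rw [← Ideal.mem_span_singleton]
  have := algHom_sub_mem (Ideal.span {X m - rename m.succAbove s}) (AlgHom.id ℝ _)
    ((rename m.succAbove).comp (substVar m s)) (fun i => ?_) p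
  · simpa [h] using this
  · rcases Fin.eq_self_or_eq_succAbove m i with rfl | ⟨j, rfl⟩
    · simp
    · simp

theorem X_dvd_of_substVar_eq_zero {n : ℕ} (m : Fin (n + 1))
    {p : MvPolynomial (Fin (n + 1)) ℝ} (h : substVar m 0 p = 0) : X m ∣ p := by
  simpa using dvd_of_substVar_eq_zero m 0 h

/-- The barycentric coordinate `1 - ∑ Xᵢ` of the corner simplex. -/
noncomputable def bary0 (n : ℕ) : MvPolynomial (Fin n) ℝ := 1 - ∑ i, X i

theorem bary0_dvd_of_substVar_eq_zero {n : ℕ} {p : MvPolynomial (Fin (n + 1)) ℝ}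
    (h : substVar 0 (bary0 n) p = 0) : bary0 (n + 1) ∣ p := by
  have := dvd_of_substVar_eq_zero 0 (bary0 n) h
  rw [← neg_dvd] at this
  convert this using 1
  simp [bary0, Fin.sum_univ_succ]
  ring

theorem bary0_mem_polyLE (n : ℕ) : bary0 n ∈ polyLE n 1 :=
  sub_mem (polyLE_mono zero_le_one (C_mem_polyLE n 1)) (sum_mem fun i _ => X_mem_polyLE i)

theorem eval_zero_bary0 (n : ℕ) : eval 0 (bary0 n) = 1 := by simp [bary0]

theorem bary0_ne_zero (n : ℕ) : bary0 n ≠ 0 := fun h => by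
  simpa [h] using eval_zero_bary0 n

theorem totalDegree_bary0 (n : ℕ) : (bary0 (n + 1)).totalDegree = 1 := by
  refine le_antisymm (mem_polyLE_natCast.1 (bary0_mem_polyLE _)) ?_
  by_contra h
  have h0 : (bary0 (n + 1)).totalDegree = 0 := by omega
  rw [totalDegree_eq_zero_iff_eq_C] at h0
  -- A constant would take equal values at the origin, where `bary0` is 1, and at the barycentre of
  -- the slanted facet, where it is 0.
  have h1 : eval (fun _ : Fin (n + 1) => (1 / (n + 1) : ℝ)) (bary0 (n + 1)) =
    eval 0 (bary0 (n + 1)) := by rw [h0]; simp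
  rw [eval_zero_bary0] at h1
  simp [bary0] at h1
  field_simp at h1
  exact absurd h1 (by positivity)

theorem isRelPrime_X {n : ℕ} {i j : Fin n} (h : i ≠ j) :
    IsRelPrime (X i : MvPolynomial (Fin n) ℝ) (X j) := by
  refine ((X_prime (i := i)).irreducible.isRelPrime_iff_not_dvd).2 fun hd => ?_
  rw [X_dvd_X] at hd
  simp_all

theorem prod_X_ne_zero {n : ℕ} (s : Finset (Fin n)) :
    (∏ i ∈ s, X i : MvPolynomial (Fin n) ℝ) ≠ 0 :=
  Finset.prod_ne_zero_iff.2 fun i _ => X_ne_zero i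

theorem totalDegree_prod_X {n : ℕ} (s : Finset (Fin n)) :
    (∏ i ∈ s, X i : MvPolynomial (Fin n) ℝ).totalDegree = s.card := by
  induction s using Finset.induction_on with
  | empty => simp
  | insert a s ha ih =>
    rw [Finset.prod_insert ha, totalDegree_mul_of_isDomain (X_ne_zero _) (prod_X_ne_zero s), ih,
      totalDegree_X, Finset.card_insert_of_notMem ha, add_comm]

theorem prod_erase_mul_X {n : ℕ} (j : Fin n) :
    (∏ i ∈ Finset.univ.erase j, X i) * X j = (∏ i, X i : MvPolynomial (Fin n) ℝ) :=
  Finset.prod_erase_mul _ _ (Finset.mem_univ j)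

/-- The component `u j` is tangential on each facet `X i = 0` with `i ≠ j`, so these coprime `X i`
all divide it. Then `u · x = (∏ X i) ∑ v j`, so the condition on `u · x` bounds `∑ v j` one degree
lower than the single `v j`. -/
theorem exists_eq_prod_erase_mul {m : ℕ} {k : ℤ}
    {u : Fin (m + 1) → MvPolynomial (Fin (m + 1)) ℝ} (hu : u ∈ nedelec (m + 1) k)
    (hX : ∀ i j, j ≠ i → substVar i 0 (u j) = 0) :
    ∃ v : Fin (m + 1) → MvPolynomial (Fin (m + 1)) ℝ,
      (∀ j, u j = (∏ i ∈ Finset.univ.erase j, X i) * v j) ∧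
      (∀ j, v j ∈ polyLE (m + 1) (k - m)) ∧ ∑ j, v j ∈ polyLE (m + 1) (k - (m + 1 : ℕ)) := by
  have hdvd : ∀ j, ∃ v, u j = (∏ i ∈ Finset.univ.erase j, X i) * v := fun j =>
    Finset.prod_dvd_of_isRelPrime (fun a _ b _ hab => isRelPrime_X hab) fun i hi =>
      X_dvd_of_substVar_eq_zero i (hX i j (Finset.ne_of_mem_erase hi).symm)
  choose v hv using hdvd
  refine ⟨v, hv, fun j => ?_, ?_⟩
  · have := mem_polyLE_of_mul_mem (prod_X_ne_zero _) (hv j ▸ hu.1 j)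
    rwa [totalDegree_prod_X, Finset.card_erase_of_mem (Finset.mem_univ _), Finset.card_univ,
      Fintype.card_fin] at this
  · have h := hu.2
    have h1 : ∑ i, u i * X i = (∏ i, X i) * ∑ j, v j := by
      rw [Finset.mul_sum]
      refine Finset.sum_congr rfl fun j _ => ?_
      rw [hv j, ← prod_erase_mul_X j]; ring
    rw [h1] at h
    have := mem_polyLE_of_mul_mem (prod_X_ne_zero _) h
    rwa [totalDegree_prod_X, Finset.card_univ, Fintype.card_fin] at this

theorem substVar_bary0_X_ne_zero {n : ℕ} (j : Fin (n + 1)) : substVar 0 (bary0 n) (X j) ≠ 0 := by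
  rcases Fin.eq_self_or_eq_succAbove 0 j with rfl | ⟨i, rfl⟩
  · rw [substVar_X_same]; exact bary0_ne_zero _
  · rw [substVar_X_succAbove]; exact X_ne_zero _

theorem substVar_bary0_mem_polyLE {n : ℕ} {a : ℤ} {p : MvPolynomial (Fin (n + 1)) ℝ}
    (hp : p ∈ polyLE (n + 1) a) : substVar 0 (bary0 n) p ∈ polyLE n a := by
  refine aeval_mem_polyLE (fun i => ?_) hp
  rcases Fin.eq_self_or_eq_succAbove 0 i with rfl | ⟨j, rfl⟩
  · rw [Fin.insertNth_apply_same]; exact bary0_mem_polyLE _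
  · rw [Fin.insertNth_apply_succAbove]; exact X_mem_polyLE _

theorem substVar_cross {m : ℕ} {u v : Fin (m + 1) → MvPolynomial (Fin (m + 1)) ℝ}
    (hv : ∀ j, u j = (∏ i ∈ Finset.univ.erase j, X i) * v j) {j l : Fin (m + 1)}
    (h : substVar 0 (bary0 m) (u j) = substVar 0 (bary0 m) (u l)) :
    substVar 0 (bary0 m) (X l) * substVar 0 (bary0 m) (v j) =
      substVar 0 (bary0 m) (X j) * substVar 0 (bary0 m) (v l) := by
  by_cases hjl : j = l
  · rw [hjl]
  rw [hv j, hv l,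
    ← Finset.mul_prod_erase (Finset.univ.erase j) X (a := l) (by simp [Ne.symm hjl]),
    ← Finset.mul_prod_erase (Finset.univ.erase l) X (a := j) (by simp [hjl]),
    Finset.erase_right_comm] at h
  simp only [map_mul] at h
  have hne : substVar 0 (bary0 m) (∏ i ∈ (Finset.univ.erase l).erase j, X i) ≠ 0 := by
    rw [map_prod]; exact Finset.prod_ne_zero_iff.2 fun i _ => substVar_bary0_X_ne_zero i
  refine mul_right_cancel₀ hne ?_
  linear_combination h

/-- On the slanted facet the vector `v` is parallel to `x`. Since the restricted coordinates `X 0`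
and `X 1` are coprime, the factor `S` is a polynomial there; what remains is divisible by `bary0`.
-/
theorem exists_eq_X_mul_add_bary0_mul {m : ℕ} {a : ℤ}
    {v : Fin (m + 2) → MvPolynomial (Fin (m + 2)) ℝ} (hdeg : ∀ j, v j ∈ polyLE (m + 2) (a + 1))
    (hcross : ∀ j l, substVar 0 (bary0 (m + 1)) (X l) * substVar 0 (bary0 (m + 1)) (v j) =
      substVar 0 (bary0 (m + 1)) (X j) * substVar 0 (bary0 (m + 1)) (v l)) :
    ∃ (S : MvPolynomial (Fin (m + 2)) ℝ) (r : Fin (m + 2) → MvPolynomial (Fin (m + 2)) ℝ),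
      S ∈ polyLE (m + 2) a ∧ (∀ j, r j ∈ polyLE (m + 2) a) ∧
      ∀ j, v j = X j * S + bary0 (m + 2) * r j := by
  have hX1 : substVar 0 (bary0 (m + 1)) (X (Fin.succAbove 0 0)) = X 0 := substVar_X_succAbove _ _ _
  obtain ⟨s, hs⟩ : X 0 ∣ substVar 0 (bary0 (m + 1)) (v (Fin.succAbove 0 0)) := by
    have h := hcross (Fin.succAbove 0 0) 0
    rw [substVar_X_same, hX1] at h
    -- The eliminated variable restricts to `bary0`, whose constant term is 1, so the prime `X 0`
    -- does not divide it.
    refine ((X_prime (R := ℝ) (i := (0 : Fin (m + 1)))).dvd_or_dvd ⟨_, h⟩).resolve_left ?_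
    rintro ⟨c, hc⟩
    have := eval_zero_bary0 (m + 1)
    rw [hc] at this
    simp at this
  have hφv : ∀ j, substVar 0 (bary0 (m + 1)) (v j) = substVar 0 (bary0 (m + 1)) (X j) * s :=
    fun j => by
      have h := hcross j (Fin.succAbove 0 0)
      rw [hs, hX1] at h
      refine mul_left_cancel₀ (X_ne_zero (0 : Fin (m + 1))) ?_
      linear_combination h
  have hsdeg : s ∈ polyLE (m + 1) a := by
    have h1 := substVar_bary0_mem_polyLE (hdeg (Fin.succAbove 0 0))
    rw [hs] at h1
    have := mem_polyLE_of_mul_mem (X_ne_zero _) h1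
    rw [totalDegree_X] at this
    simpa using this
  have hφS : substVar 0 (bary0 (m + 1)) (rename (Fin.succAbove 0) s) = s := by
    have : (substVar 0 (bary0 (m + 1))).comp (rename (Fin.succAbove 0)) = AlgHom.id ℝ _ :=
      algHom_ext fun i => by
        rw [AlgHom.comp_apply, rename_X, substVar_X_succAbove, AlgHom.id_apply]
    exact DFunLike.congr_fun this s
  have hSdeg : rename (Fin.succAbove 0) s ∈ polyLE (m + 2) a :=
    rename_mem_polyLE _ hsdeg
  have hr : ∀ j, ∃ r, v j - X j * rename (Fin.succAbove 0) s = bary0 (m + 2) * r := fun j =>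
    bary0_dvd_of_substVar_eq_zero (by rw [map_sub, map_mul, hφv, hφS, sub_self])
  choose r hr using hr
  refine ⟨_, r, hSdeg, fun j => ?_, fun j => by rw [← hr j]; ring⟩
  have h1 : v j - X j * rename (Fin.succAbove 0) s ∈ polyLE (m + 2) (a + 1) :=
    sub_mem (hdeg j) (by rw [add_comm a]; exact mul_mem_polyLE (X_mem_polyLE j) hSdeg)
  rw [hr j] at h1
  have := mem_polyLE_of_mul_mem (bary0_ne_zero _) h1
  rw [totalDegree_bary0] at this
  simpa using this

/-- Summing `hr` with `∑ X j = 1 - bary0` gives `∑ v j - S = bary0 * (∑ r j - S)`; cancelling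
`bary0` gains one degree. -/
theorem sum_sub_mem_polyLE {m : ℕ} {a : ℤ} {S : MvPolynomial (Fin (m + 1)) ℝ}
    {v r : Fin (m + 1) → MvPolynomial (Fin (m + 1)) ℝ} (hv : ∑ j, v j ∈ polyLE (m + 1) a)
    (hS : S ∈ polyLE (m + 1) a) (hr : ∀ j, v j = X j * S + bary0 (m + 1) * r j) :
    ∑ j, r j - S ∈ polyLE (m + 1) (a - 1) := by
  have hsumv : ∑ j, v j - S = bary0 (m + 1) * (∑ j, r j - S) := by
    simp only [hr, Finset.sum_add_distrib, ← Finset.sum_mul, ← Finset.mul_sum]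
    rw [bary0]; ring
  have h1 := sub_mem hv hS
  rw [hsumv] at h1
  have := mem_polyLE_of_mul_mem (bary0_ne_zero _) h1
  rwa [totalDegree_bary0] at this

/-- The form of a polynomial 1-form in `nedelec` whose traces on the facets of the corner simplex
vanish. -/
theorem exists_bubble_form {m : ℕ} {k : ℤ} {u : Fin (m + 2) → MvPolynomial (Fin (m + 2)) ℝ}
    (hu : u ∈ nedelec (m + 2) k) (hX : ∀ i j, j ≠ i → substVar i 0 (u j) = 0)
    (h0 : ∀ i j, substVar 0 (bary0 (m + 1)) (u i) = substVar 0 (bary0 (m + 1)) (u j)) :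
    ∃ R : Fin (m + 2) → MvPolynomial (Fin (m + 2)) ℝ,
      (∀ i, R i ∈ polyLE (m + 2) (k - (m + 2 : ℕ))) ∧
      ∀ j, u j = (∏ i, X i) * ∑ i, R i +
        bary0 (m + 2) * (∏ i ∈ Finset.univ.erase j, X i) * R j := by
  obtain ⟨v, hv, hvdeg, hsum⟩ := exists_eq_prod_erase_mul hu hX
  have e : k - (m + 1 : ℕ) = k - (m + 2 : ℕ) + 1 := by push_cast; ring
  rw [e] at hvdeg
  obtain ⟨S, r, hS, hr, hvr⟩ := exists_eq_X_mul_add_bary0_mul hvdeg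
    fun j l => substVar_cross hv (h0 j l)
  have hρ := sum_sub_mem_polyLE hsum hS hvr
  -- With ρ = ∑ r i - S, this choice gives `∑ R i = S + bary0 * ρ`, and the terms in ρ cancel in the
  -- asserted form. The extra degree drop of ρ keeps `X j * ρ` within the bound.
  refine ⟨fun j => r j - X j * (∑ i, r i - S), fun j => sub_mem (hr j) ?_, fun j => ?_⟩
  · have := mul_mem_polyLE (X_mem_polyLE j) hρ
    rwa [add_sub_cancel] at this
  · have hsumX : ∑ j, X j = 1 - bary0 (m + 2) := by simp [bary0]
    rw [Finset.sum_sub_distrib, ← Finset.sum_mul, hsumX, hv j, ← prod_erase_mul_X j, hvr j]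
    ring

/-! ### Affine pullback and traces on facets. -/

section Pullback

variable {N d : ℕ}

/-- The affine map of the corner simplex onto the simplex with vertices `w`, as a tuple of
polynomials. -/
noncomputable def affineSubst (w : Fin (d + 1) → Fin N → ℝ) (i : Fin N) : MvPolynomial (Fin d) ℝ :=
  C (w 0 i) + ∑ j, (w (Fin.succ j) i - w 0 i) • X j

/-- The pullback of polynomial 1-forms under `affineSubst w`. -/
noncomputable def pull (w : Fin (d + 1) → Fin N → ℝ) :
    (Fin N → MvPolynomial (Fin N) ℝ) →ₗ[ℝ] (Fin d → MvPolynomial (Fin d) ℝ) :=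
  LinearMap.pi fun j => ∑ i, (w (Fin.succ j) i - w 0 i) •
    ((aeval (affineSubst w)).toLinearMap ∘ₗ LinearMap.proj i)

theorem pull_apply (w : Fin (d + 1) → Fin N → ℝ) (E : Fin N → MvPolynomial (Fin N) ℝ)
    (j : Fin d) : pull w E j = ∑ i, (w j.succ i - w 0 i) • aeval (affineSubst w) (E i) := by
  simp [pull]

theorem affineSubst_mem_polyLE (w : Fin (d + 1) → Fin N → ℝ) (i : Fin N) :
    affineSubst w i ∈ polyLE d 1 :=
  add_mem (polyLE_mono zero_le_one (C_mem_polyLE _ _))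
    (sum_mem fun j _ => Submodule.smul_mem _ _ (X_mem_polyLE j))

/-- With x = w₀ + D t, the contraction of the pullback with t is E · (D t) = E · x - E · w₀, and
both terms have degree at most `k`. -/
theorem pull_mem_nedelec {k : ℤ} (w : Fin (d + 1) → Fin N → ℝ)
    {E : Fin N → MvPolynomial (Fin N) ℝ} (hE : E ∈ nedelec N k) : pull w E ∈ nedelec d k := by
  have hi : ∀ i, aeval (affineSubst w) (E i) ∈ polyLE d k := fun i =>
    aeval_mem_polyLE (affineSubst_mem_polyLE w) (hE.1 i)
  refine ⟨fun j => ?_, ?_⟩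
  · rw [pull_apply]
    exact sum_mem fun i _ => Submodule.smul_mem _ _ (hi i)
  · have h : ∑ j, pull w E j * X j =
        aeval (affineSubst w) (∑ i, E i * X i) - ∑ i, w 0 i • aeval (affineSubst w) (E i) := by
      simp only [pull_apply, Finset.sum_mul, map_sum, map_mul, aeval_X]
      rw [Finset.sum_comm, ← Finset.sum_sub_distrib]
      refine Finset.sum_congr rfl fun i _ => ?_
      rw [affineSubst, mul_add, Finset.mul_sum, mul_comm _ (C _), ← smul_eq_C_mul,
        add_sub_cancel_left]
      exact Finset.sum_congr rfl fun j _ => by rw [smul_mul_assoc, mul_smul_comm]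
    rw [h]
    exact sub_mem (aeval_mem_polyLE (affineSubst_mem_polyLE w) hE.2)
      (sum_mem fun i _ => Submodule.smul_mem _ _ (hi i))

theorem pull_pull {e : ℕ} (w : Fin (d + 1) → Fin N → ℝ) (w' : Fin (e + 1) → Fin d → ℝ)
    (E : Fin N → MvPolynomial (Fin N) ℝ) :
    pull w' (pull w E) =
      pull (fun a i => w 0 i + ∑ j, w' a j * (w j.succ i - w 0 i)) E := by
  have hs : (aeval (affineSubst w')).comp (aeval (affineSubst w)) =
      aeval (R := ℝ) (affineSubst (fun a i => w 0 i + ∑ j, w' a j * (w j.succ i - w 0 i))) := by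
    refine algHom_ext fun i => ?_
    simp only [AlgHom.comp_apply, aeval_X, affineSubst, map_add, map_sum, map_smul, map_mul,
      algHom_C, algebraMap_eq, smul_add, Finset.sum_add_distrib, Finset.smul_sum, smul_smul,
      add_sub_add_left_eq_sub, ← Finset.sum_sub_distrib, ← sub_mul, Finset.sum_smul]
    rw [add_assoc]
    congr 2
    · exact Finset.sum_congr rfl fun j _ => by rw [smul_eq_C_mul, ← C_mul, mul_comm, map_mul]
    · rw [Finset.sum_comm]
      exact Finset.sum_congr rfl fun j _ => Finset.sum_congr rfl fun l _ => by rw [mul_comm]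
  funext j
  simp only [pull_apply, map_sum, map_smul, ← AlgHom.comp_apply, hs, Finset.smul_sum, smul_smul,
    add_sub_add_left_eq_sub, ← Finset.sum_sub_distrib, ← sub_mul, Finset.sum_smul]
  rw [Finset.sum_comm]

/-- The vertices of the corner simplex. -/
def cornerVertex (n : ℕ) : Fin (n + 1) → Fin n → ℝ := Fin.cons 0 fun j => Pi.single j 1

/-- Reduces a trace on a facet of any simplex to a trace on a facet of the corner simplex; this
drives the passage from faces to their subfaces. -/
theorem pull_comp_succAbove {n : ℕ} (w : Fin (n + 2) → Fin N → ℝ) (b : Fin (n + 2))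
    (E : Fin N → MvPolynomial (Fin N) ℝ) :
    pull (w ∘ b.succAbove) E = pull (cornerVertex (n + 1) ∘ b.succAbove) (pull w E) := by
  rw [pull_pull]
  congr 2
  funext a i
  simp only [Function.comp_apply]
  refine Fin.cases ?_ (fun c => ?_) (b.succAbove a)
  · simp [cornerVertex]
  · simp [cornerVertex, Pi.single_apply]

theorem pull_cornerVertex_zero {n : ℕ} (u : Fin (n + 1) → MvPolynomial (Fin (n + 1)) ℝ)
    (j : Fin n) : pull (cornerVertex (n + 1) ∘ Fin.succAbove 0) u j =
      substVar 0 (bary0 n) (u j.succ) - substVar 0 (bary0 n) (u 0) := by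
  have hs : affineSubst (cornerVertex (n + 1) ∘ Fin.succAbove 0) =
      Fin.insertNth (α := fun _ => MvPolynomial (Fin n) ℝ) 0 (bary0 n) X := by
    funext i
    rcases Fin.eq_self_or_eq_succAbove 0 i with rfl | ⟨j, rfl⟩
    · simp [affineSubst, cornerVertex, bary0, sub_eq_add_neg, Fin.succ_ne_zero]
    · simp [affineSubst, cornerVertex, Pi.single_apply, ite_smul, Fin.succ_ne_zero]
  rw [pull_apply, hs]
  change ∑ i, _ • substVar 0 (bary0 n) (u i) = _
  simp [cornerVertex, Pi.single_apply, sub_smul, Finset.sum_sub_distrib, ite_smul]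

theorem pull_cornerVertex_succ {n : ℕ} (u : Fin (n + 1) → MvPolynomial (Fin (n + 1)) ℝ)
    (b : Fin (n + 1)) (j : Fin n) : pull (cornerVertex (n + 1) ∘ Fin.succAbove b.succ) u j =
      substVar b 0 (u (b.succAbove j)) := by
  have hs : affineSubst (cornerVertex (n + 1) ∘ Fin.succAbove b.succ) =
      Fin.insertNth (α := fun _ => MvPolynomial (Fin n) ℝ) b 0 X := by
    funext i
    rcases Fin.eq_self_or_eq_succAbove b i with rfl | ⟨j, rfl⟩
    · simp [affineSubst, cornerVertex]
    · simp [affineSubst, cornerVertex, Pi.single_apply, ite_smul]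
  rw [pull_apply, hs]
  change ∑ i, _ • substVar b 0 (u i) = _
  simp [cornerVertex, Pi.single_apply, ite_smul]

theorem exists_bubble_form_of_pull_eq_zero {m : ℕ} {k : ℤ}
    {u : Fin (m + 2) → MvPolynomial (Fin (m + 2)) ℝ} (hu : u ∈ nedelec (m + 2) k)
    (h : ∀ b : Fin (m + 3), pull (cornerVertex (m + 2) ∘ b.succAbove) u = 0) :
    ∃ R : Fin (m + 2) → MvPolynomial (Fin (m + 2)) ℝ,
      (∀ i, R i ∈ polyLE (m + 2) (k - (m + 2 : ℕ))) ∧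
      ∀ j, u j = (∏ i, X i) * ∑ i, R i +
        bary0 (m + 2) * (∏ i ∈ Finset.univ.erase j, X i) * R j := by
  refine exists_bubble_form hu (fun i j hij => ?_) fun i j => ?_
  · obtain ⟨l, rfl⟩ := Fin.exists_succAbove_eq hij
    rw [← pull_cornerVertex_succ, h, Pi.zero_apply]
  · have h0 : ∀ i, substVar 0 (bary0 (m + 1)) (u i) = substVar 0 (bary0 (m + 1)) (u 0) := by
      refine Fin.cases rfl fun i => ?_
      rw [← sub_eq_zero, ← pull_cornerVertex_zero, h, Pi.zero_apply]
    rw [h0 i, h0 j]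

end Pullback

/-! ### Positivity and integration on the corner simplex. -/

section Corner

variable {n : ℕ}

theorem isCompact_corner (n : ℕ) : IsCompact (corner n) := by
  refine (isCompact_univ_pi fun _ : Fin n => isCompact_Icc (a := (0 : ℝ)) (b := 1)).of_isClosed_subset
    ?_ fun t ht i _ => ⟨ht.1 i, ?_⟩
  · simp only [corner, Set.ofPred_and, Set.ofPred_forall]
    exact (isClosed_iInter fun i => isClosed_le continuous_const (continuous_apply i)).inter
      (isClosed_le (by fun_prop) continuous_const)
  · exact (Finset.single_le_sum (fun j _ => ht.1 j) (Finset.mem_univ i)).trans ht.2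

/-- The interior of the corner simplex. -/
def openCorner (n : ℕ) : Set (Fin n → ℝ) := {t | (∀ i, 0 < t i) ∧ ∑ i, t i < 1}

theorem isOpen_openCorner (n : ℕ) : IsOpen (openCorner n) := by
  simp only [openCorner, Set.ofPred_and, Set.ofPred_forall]
  exact (isOpen_iInter_of_finite fun i => isOpen_lt continuous_const (continuous_apply i)).inter
    (isOpen_lt (by fun_prop) continuous_const)

theorem openCorner_subset_corner (n : ℕ) : openCorner n ⊆ corner n :=
  fun _ ht => ⟨fun i => (ht.1 i).le, ht.2.le⟩

theorem eq_zero_of_eval_openCorner {p : MvPolynomial (Fin n) ℝ}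
    (h : ∀ t ∈ openCorner n, eval t p = 0) : p = 0 := by
  -- The side is chosen so that this open box lies inside the open corner; a polynomial vanishing on
  -- a product of infinite sets is zero.
  refine funext_set (fun _ => Set.Ioo (0 : ℝ) (1 / (n + 1)))
    (fun _ => Set.Ioo_infinite (by positivity)) fun t ht => ?_
  rw [map_zero]
  refine h t ⟨fun i => (ht i trivial).1, ?_⟩
  calc ∑ i, t i ≤ ∑ _i : Fin n, (1 / (n + 1) : ℝ) :=
        Finset.sum_le_sum fun i _ => (ht i trivial).2.le
    _ < 1 := by
        simp only [Finset.sum_const, Finset.card_univ, Fintype.card_fin, nsmul_eq_mul]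
        rw [mul_one_div, div_lt_one (by positivity)]
        linarith

theorem eval_bary0 (t : Fin n → ℝ) : eval t (bary0 n) = 1 - ∑ i, t i := by simp [bary0]

theorem sum_bubble_mul {u R : Fin n → MvPolynomial (Fin n) ℝ}
    (h : ∀ j, u j = (∏ i, X i) * ∑ i, R i + bary0 n * (∏ i ∈ Finset.univ.erase j, X i) * R j)
    (t : Fin n → ℝ) : ∑ j, eval t (u j) * eval t (R j) =
      (∏ i, t i) * (∑ i, eval t (R i)) ^ 2 +
        ∑ j, (1 - ∑ i, t i) * (∏ i ∈ Finset.univ.erase j, t i) * eval t (R j) ^ 2 := by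
  rw [sq, ← mul_assoc, Finset.mul_sum Finset.univ (fun i => eval t (R i)) (_ * _),
    ← Finset.sum_add_distrib]
  refine Finset.sum_congr rfl fun j _ => ?_
  rw [h j]
  simp only [map_add, map_mul, map_sum, map_prod, eval_X, eval_bary0]
  ring

theorem sum_bubble_mul_nonneg {u R : Fin n → MvPolynomial (Fin n) ℝ}
    (h : ∀ j, u j = (∏ i, X i) * ∑ i, R i + bary0 n * (∏ i ∈ Finset.univ.erase j, X i) * R j)
    {t : Fin n → ℝ} (ht : t ∈ corner n) : 0 ≤ ∑ j, eval t (u j) * eval t (R j) := by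
  rw [sum_bubble_mul h]
  have h1 := sub_nonneg.2 ht.2
  refine add_nonneg (mul_nonneg (Finset.prod_nonneg fun i _ => ht.1 i) (sq_nonneg _))
    (Finset.sum_nonneg fun j _ =>
      mul_nonneg (mul_nonneg h1 (Finset.prod_nonneg fun i _ => ht.1 i)) (sq_nonneg _))

theorem eq_zero_of_sum_bubble_mul {u R : Fin n → MvPolynomial (Fin n) ℝ}
    (h : ∀ j, u j = (∏ i, X i) * ∑ i, R i + bary0 n * (∏ i ∈ Finset.univ.erase j, X i) * R j)
    (h0 : ∀ t ∈ openCorner n, ∑ j, eval t (u j) * eval t (R j) = 0) : u = 0 := by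
  have hR : ∀ j, R j = 0 := fun j => eq_zero_of_eval_openCorner fun t ht => by
    have h1 := sub_pos.2 ht.2
    have hpos : ∀ l ∈ Finset.univ,
        0 ≤ (1 - ∑ i, t i) * (∏ i ∈ Finset.univ.erase l, t i) * eval t (R l) ^ 2 := fun l _ =>
      mul_nonneg (mul_nonneg h1.le (Finset.prod_nonneg fun i _ => (ht.1 i).le)) (sq_nonneg _)
    have h2 := h0 t ht
    rw [sum_bubble_mul h] at h2
    have h3 := (add_eq_zero_iff_of_nonneg (mul_nonneg (Finset.prod_nonneg fun i _ => (ht.1 i).le)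
      (sq_nonneg _)) (Finset.sum_nonneg hpos)).1 h2
    have h4 := (Finset.sum_eq_zero_iff_of_nonneg hpos).1 h3.2 j (Finset.mem_univ j)
    have h5 : 0 < (1 - ∑ i, t i) * ∏ i ∈ Finset.univ.erase j, t i :=
      mul_pos h1 (Finset.prod_pos fun i _ => ht.1 i)
    exact pow_eq_zero_iff two_ne_zero |>.1 ((mul_eq_zero.1 h4).resolve_left h5.ne')
  funext j
  rw [h j]
  simp [hR]

open MeasureTheory in
/-- A continuous function that is nonnegative on a compact set and has integral zero over it
vanishes on the open subsets. -/
theorem eq_zero_on_open_of_setIntegral_eq_zero {X : Type*} [TopologicalSpace X] [T2Space X]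
    [MeasurableSpace X] [BorelSpace X] (μ : Measure X) [IsFiniteMeasureOnCompacts μ]
    [μ.IsOpenPosMeasure] {K U : Set X} (hK : IsCompact K) (hU : IsOpen U) (hUK : U ⊆ K)
    {g : X → ℝ} (hg : Continuous g) (hnonneg : ∀ x ∈ K, 0 ≤ g x) (hint : ∫ x in K, g x ∂μ = 0)
    {x : X} (hx : x ∈ U) : g x = 0 := by
  have h1 : g =ᵐ[μ.restrict K] 0 := (setIntegral_eq_zero_iff_of_nonneg_ae
    ((ae_restrict_iff' hK.measurableSet).2 (ae_of_all _ hnonneg))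
    (hg.continuousOn.integrableOn_compact hK)).1 hint
  have h2 : g =ᵐ[μ.restrict U] 0 := ae_restrict_of_ae_restrict_of_subset hUK h1
  exact Measure.eqOn_open_of_ae_eq h2 hU hg.continuousOn continuousOn_const hx

/-- Integration of polynomials over a compact set. -/
noncomputable def compactIntegral {X : Type*} [TopologicalSpace X] [T2Space X]
    [MeasurableSpace X] [BorelSpace X] (μ : MeasureTheory.Measure X)
    [MeasureTheory.IsFiniteMeasureOnCompacts μ] {K : Set X} (hK : IsCompact K)
    (c : X → Fin n → ℝ) (hc : Continuous c) : MvPolynomial (Fin n) ℝ →ₗ[ℝ] ℝ where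
  toFun p := ∫ x in K, eval (c x) p ∂μ
  map_add' p q := by
    have hint : ∀ p : MvPolynomial (Fin n) ℝ,
        MeasureTheory.IntegrableOn (fun x => eval (c x) p) K μ := fun p =>
      ((continuous_eval p).comp hc).continuousOn.integrableOn_compact hK
    simp only [map_add]
    exact MeasureTheory.integral_add (hint p) (hint q)
  map_smul' a p := by
    simp only [smul_eval, RingHom.id_apply, smul_eq_mul]
    exact MeasureTheory.integral_const_mul a _

/-- Integration of polynomials over the corner simplex. -/
noncomputable def cornerIntegral (n : ℕ) : MvPolynomial (Fin n) ℝ →ₗ[ℝ] ℝ :=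
  compactIntegral MeasureTheory.volume (isCompact_corner n) id continuous_id

theorem cornerIntegral_apply (p : MvPolynomial (Fin n) ℝ) :
    cornerIntegral n p = ∫ t in corner n, eval t p :=
  rfl

theorem eval_eq_zero_of_cornerIntegral {p : MvPolynomial (Fin n) ℝ}
    (h0 : ∀ t ∈ corner n, 0 ≤ eval t p) (h : cornerIntegral n p = 0) {t : Fin n → ℝ}
    (ht : t ∈ openCorner n) : eval t p = 0 :=
  eq_zero_on_open_of_setIntegral_eq_zero MeasureTheory.volume (isCompact_corner n)
    (isOpen_openCorner n) (openCorner_subset_corner n) (continuous_eval p) h0 h ht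

/-- The inductive step in dimension at least 2: the bubble coefficients `R` are themselves an
admissible test field, and the integrand they produce is nonnegative. -/
theorem eq_zero_of_cornerIntegral {m : ℕ} {k : ℤ}
    {u : Fin (m + 2) → MvPolynomial (Fin (m + 2)) ℝ} (hu : u ∈ nedelec (m + 2) k)
    (h : ∀ b : Fin (m + 3), pull (cornerVertex (m + 2) ∘ b.succAbove) u = 0)
    (hint : ∀ q : Fin (m + 2) → MvPolynomial (Fin (m + 2)) ℝ,
      (∀ i, q i ∈ polyLE (m + 2) (k - (m + 2 : ℕ))) →
        cornerIntegral (m + 2) (∑ i, u i * q i) = 0) : u = 0 := by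
  obtain ⟨R, hR, huR⟩ := exists_bubble_form_of_pull_eq_zero hu h
  have he : ∀ t, eval t (∑ i, u i * R i) = ∑ j, eval t (u j) * eval t (R j) := fun t => by simp
  refine eq_zero_of_sum_bubble_mul huR fun t ht => ?_
  rw [← he]
  exact eval_eq_zero_of_cornerIntegral
    (fun t ht => (he t).symm ▸ sum_bubble_mul_nonneg huR ht) (hint R hR) ht

theorem eq_zero_of_cornerIntegral_one {k : ℤ} {u : Fin 1 → MvPolynomial (Fin 1) ℝ}
    (hu : u ∈ nedelec 1 k)
    (hint : ∀ q ∈ polyLE 1 (k - 1), cornerIntegral 1 (u 0 * q) = 0) : u = 0 := by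
  have h1 : u 0 ∈ polyLE 1 (k - 1) := by
    have h := hu.2
    rw [Fin.sum_univ_one, mul_comm] at h
    have := mem_polyLE_of_mul_mem (X_ne_zero _) h
    rwa [totalDegree_X] at this
  funext i
  rw [Subsingleton.elim i 0]
  refine eq_zero_of_eval_openCorner fun t ht => ?_
  have := eval_eq_zero_of_cornerIntegral (fun t _ => ?_) (hint _ h1) ht
  · rw [map_mul] at this
    exact mul_self_eq_zero.1 this
  · rw [map_mul]
    exact mul_self_nonneg _

end Corner

/-! ### Dimension count. -/

theorem finite_degree_le (n : ℕ) (m : ℤ) : Finite {α : Fin n →₀ ℕ | (α.degree : ℤ) ≤ m} :=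
  ((Finsupp.finite_of_degree_le m.toNat).subset fun α hα => by
    have : (α.degree : ℤ) ≤ m := hα
    change α.degree ≤ m.toNat
    omega).to_subtype

instance finite_polyLE (n : ℕ) (m : ℤ) : Module.Finite ℝ (polyLE n m) :=
  have := finite_degree_le n m
  Module.Finite.of_basis (basisRestrictSupport ℝ _)

theorem card_degree_le (n m : ℕ) :
    Nat.card {α : Fin n →₀ ℕ | (α.degree : ℤ) ≤ m} = (n + 1).multichoose m := by
  classical
  have key : ∀ m : ℕ, ((Finset.range (m + 1)).biUnion fun l =>
      (Finset.univ : Finset (Fin n)).finsuppAntidiag l).card = (n + 1).multichoose m := by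
    intro m
    induction m with
    | zero => simp
    | succ m ih =>
      rw [Finset.range_add_one, Finset.biUnion_insert, Finset.card_union_of_disjoint, ih,
        Finset.card_finsuppAntidiag_nat_eq_multichoose, Nat.multichoose_succ_succ,
        Finset.card_univ, Fintype.card_fin]
      rw [Finset.disjoint_left]
      intro α h1 h2
      simp only [Finset.mem_finsuppAntidiag, Finset.mem_biUnion, Finset.mem_range] at h1 h2
      obtain ⟨l, hl, h2⟩ := h2
      omega
  rw [← key m, Nat.card_coe_set_eq, ← Set.ncard_coe_finset]
  congr 1
  ext α
  simp only [Finset.coe_biUnion, Set.mem_iUnion, Finset.mem_coe, Finset.mem_range,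
    Finset.mem_finsuppAntidiag, Set.mem_ofPred_eq, Finsupp.degree_eq_sum, Nat.cast_le]
  simp

/-- The shift by `n` covers negative `m` as well: then `k < n`, and both sides are zero. -/
theorem finrank_polyLE {n k : ℕ} {m : ℤ} (h : m = (k : ℤ) - (n : ℤ)) :
    Module.finrank ℝ (polyLE n m) = k.choose n := by
  have h1 : Module.finrank ℝ (polyLE n m) = Nat.card {α : Fin n →₀ ℕ | (α.degree : ℤ) ≤ m} :=
    Module.finrank_eq_nat_card_basis (basisRestrictSupport ℝ _)
  rw [h1]
  rcases le_or_gt n k with hnk | hnk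
  · obtain ⟨l, rfl⟩ := Nat.exists_eq_add_of_le hnk
    obtain rfl : m = (l : ℤ) := by rw [h]; push_cast; ring
    rw [card_degree_le, Nat.multichoose_eq, show n + 1 + l - 1 = n + l by omega,
      Nat.choose_symm_add]
  · rw [Nat.choose_eq_zero_of_lt hnk, Nat.card_eq_zero]
    refine Or.inl ⟨fun ⟨α, hα⟩ => ?_⟩
    have : (α.degree : ℤ) ≤ m := hα
    omega

theorem homogeneousComponent_mul_X {σ : Type*} (k : ℕ) (p : MvPolynomial σ ℝ) (i : σ) :
    homogeneousComponent (k + 1) (p * X i) = homogeneousComponent k p * X i := by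
  classical
  ext α
  rw [coeff_homogeneousComponent, coeff_mul_X', coeff_mul_X', coeff_homogeneousComponent]
  by_cases hi : i ∈ α.support
  · have h : α.degree = (α - Finsupp.single i 1).degree + 1 := by
      conv_lhs => rw [← tsub_add_cancel_of_le (Finsupp.single_le_iff.2
        (Nat.one_le_iff_ne_zero.2 (Finsupp.mem_support_iff.1 hi)))]
      simp
    simp only [hi, if_true, h, add_left_inj]
  · simp [hi]

/-- For `u` of degree at most `k`, the part of `u · x` of degree `k + 1` is the contraction of the
degree `k` component of `u`, so the bound on `u · x` says exactly that this contraction vanishes. -/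
theorem V1_eq_nedelec (k : ℕ) : V1 k = nedelec 4 k := by
  refine le_antisymm (sup_le (fun u hu => ?_) fun u hu => ?_) fun u hu => ?_
  · have h : ∀ i, u i ∈ polyLE 4 ((k : ℤ) - 1) := fun i => hu i trivial
    refine ⟨fun i => polyLE_mono (by omega) (h i), sum_mem fun i _ => ?_⟩
    have := mul_mem_polyLE (h i) (X_mem_polyLE i)
    rwa [sub_add_cancel] at this
  · refine ⟨fun i => mem_polyLE_natCast.2 (hu.1 i).totalDegree_le, ?_⟩
    rw [hu.2]
    exact zero_mem _
  · refine Submodule.mem_sup.2 ⟨fun i => u i - homogeneousComponent k (u i), fun i _ α hα => ?_,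
      fun i => homogeneousComponent k (u i),
      ⟨fun i => homogeneousComponent_isHomogeneous k (u i), ?_⟩, ?_⟩
    · have h1 : coeff α (u i - homogeneousComponent k (u i)) ≠ 0 := mem_support_iff.1 hα
      rw [coeff_sub, coeff_homogeneousComponent] at h1
      by_cases hd : α.degree = k
      · simp [hd] at h1
      · have h2 : (α.degree : ℤ) ≤ k := hu.1 i (mem_support_iff.2 (by simpa [hd] using h1))
        change (α.degree : ℤ) ≤ k - 1
        omega
    · simp only [← homogeneousComponent_mul_X, ← map_sum]
      exact homogeneousComponent_eq_zero _ _
        (Nat.lt_succ_of_le (mem_polyLE_natCast.1 hu.2))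
    · funext i
      exact sub_add_cancel _ _

/-- The contraction `u ↦ u · x`. -/
noncomputable def contractX (n : ℕ) (k : ℤ) : (Fin n → polyLE n k) →ₗ[ℝ] polyLE n (k + 1) where
  toFun u := ⟨∑ i, (u i : MvPolynomial (Fin n) ℝ) * X i,
    sum_mem fun i _ => mul_mem_polyLE (u i).2 (X_mem_polyLE i)⟩
  map_add' u v := by
    ext1
    simp [add_mul, Finset.sum_add_distrib]
  map_smul' c u := by
    ext1
    simp [Finset.smul_sum]

instance finite_nedelec (n : ℕ) (k : ℤ) : Module.Finite ℝ (nedelec n k) :=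
  Module.Finite.of_injective
    (LinearMap.pi fun i => ((LinearMap.proj i).comp (nedelec n k).subtype).codRestrict
      (polyLE n k) fun u => u.2.1 i : nedelec n k →ₗ[ℝ] Fin n → polyLE n k)
    fun _ _ h => Subtype.ext <| funext fun i => congrArg Subtype.val (congrFun h i)

/-- Rank-nullity for the contraction followed by the quotient P^{k+1} / P^k, whose kernel embeds in
`nedelec n k`. -/
theorem le_finrank_nedelec (n : ℕ) (k : ℤ) :
    n * Module.finrank ℝ (polyLE n k) + Module.finrank ℝ (polyLE n k) ≤
      Module.finrank ℝ (nedelec n k) + Module.finrank ℝ (polyLE n (k + 1)) := by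
  set B := (polyLE n k).comap (polyLE n (k + 1)).subtype with hB
  set g := B.mkQ ∘ₗ contractX n k with hg
  have h1 := g.finrank_range_add_finrank_ker
  have h2 := B.finrank_quotient_add_finrank
  have h3 : Module.finrank ℝ B = Module.finrank ℝ (polyLE n k) :=
    (Submodule.comapSubtypeEquivOfLe (polyLE_mono (by omega))).finrank_eq
  have h4 := Submodule.finrank_le g.range
  have h5 : Module.finrank ℝ (Fin n → polyLE n k) = n * Module.finrank ℝ (polyLE n k) := by
    simp [Module.finrank_pi_fintype]
  have h6 : Module.finrank ℝ g.ker ≤ Module.finrank ℝ (nedelec n k) := by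
    refine LinearMap.finrank_le_finrank_of_injective
      (f := ((LinearMap.pi fun i => (polyLE n k).subtype ∘ₗ
        (LinearMap.proj i : (Fin n → polyLE n k) →ₗ[ℝ] polyLE n k) ∘ₗ
        g.ker.subtype : g.ker →ₗ[ℝ] Fin n → MvPolynomial (Fin n) ℝ).codRestrict
          (nedelec n k) fun u => ⟨fun i => (u.1 i).2, ?_⟩)) ?_
    · have := LinearMap.mem_ker.1 u.2
      exact (Submodule.Quotient.mk_eq_zero B).1 this
    · intro u v h
      exact Subtype.ext <| funext fun i => Subtype.ext (congrFun (congrArg Subtype.val h) i)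
  omega

theorem card_faceIdx_le (d : ℕ) : Nat.card (FaceIdx d) ≤ (5).choose (d + 1) := by
  have h : Nat.card {s : Finset (Fin 5) // s.card = d + 1} = (5).choose (d + 1) := by
    rw [Nat.card_eq_fintype_card, Fintype.card_finset_len, Fintype.card_fin]
  rw [← h]
  refine Nat.card_le_card_of_injective
    (fun e => ⟨Finset.univ.map e.toEmbedding, by simp⟩) fun e f hef => ?_
  have h1 := congrArg (fun s : {s : Finset (Fin 5) // s.card = d + 1} => (s.1 : Set (Fin 5))) hef
  simpa [OrderEmbedding.range_inj] using h1

noncomputable instance (d : ℕ) : Fintype (FaceIdx d) := Fintype.ofFinite _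

/-- `DofValues` as a vector space. -/
abbrev DofSpace (k : ℕ) : Type :=
  (FaceIdx 1 → Module.Dual ℝ (polyLE 1 ((k : ℤ) - 1))) ×
  (FaceIdx 2 → Module.Dual ℝ (Fin 2 → polyLE 2 ((k : ℤ) - 2))) ×
  (FaceIdx 3 → Module.Dual ℝ (Fin 3 → polyLE 3 ((k : ℤ) - 3))) ×
  Module.Dual ℝ (Fin 4 → polyLE 4 ((k : ℤ) - 4))

theorem finrank_dofSpace_le (k : ℕ) : Module.finrank ℝ (DofSpace k) ≤
    10 * k.choose 1 + (10 * (2 * k.choose 2) + (5 * (3 * k.choose 3) + 4 * k.choose 4)) := by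
  have h1 := card_faceIdx_le 1
  have h2 := card_faceIdx_le 2
  have h3 := card_faceIdx_le 3
  rw [Nat.card_eq_fintype_card] at h1 h2 h3
  simp only [DofSpace, Module.finrank_prod, Module.finrank_pi_fintype, Subspace.dual_finrank_eq,
    finrank_polyLE (n := 1) (k := k) (m := (k : ℤ) - 1) rfl,
    finrank_polyLE (n := 2) (k := k) (m := (k : ℤ) - 2) rfl,
    finrank_polyLE (n := 3) (k := k) (m := (k : ℤ) - 3) rfl,
    finrank_polyLE (n := 4) (k := k) (m := (k : ℤ) - 4) rfl,
    Finset.sum_const, Finset.card_univ, Fintype.card_fin, smul_eq_mul]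
  have h1' : Fintype.card (FaceIdx 1) ≤ 10 := h1
  have h2' : Fintype.card (FaceIdx 2) ≤ 10 := h2
  have h3' : Fintype.card (FaceIdx 3) ≤ 5 := h3
  gcongr

theorem finrank_dofSpace_le_finrank_V1 (k : ℕ) :
    Module.finrank ℝ (DofSpace k) ≤ Module.finrank ℝ (V1 k) := by
  rw [V1_eq_nedelec]
  suffices H : 10 * k.choose 1 + (10 * (2 * k.choose 2) + (5 * (3 * k.choose 3) +
      4 * k.choose 4)) ≤ Module.finrank ℝ (nedelec 4 k) from (finrank_dofSpace_le k).trans H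
  have h := le_finrank_nedelec 4 k
  rw [finrank_polyLE (n := 4) (k := k + 4) (m := k) (by push_cast; ring),
    finrank_polyLE (n := 4) (k := k + 5) (m := k + 1) (by push_cast; ring)] at h
  have c2 : ∀ n : ℕ, (n + 1).choose 2 = n.choose 1 + n.choose 2 := fun n => n.choose_succ_succ' 1
  have c3 : ∀ n : ℕ, (n + 1).choose 3 = n.choose 2 + n.choose 3 := fun n => n.choose_succ_succ' 2
  have c4 : ∀ n : ℕ, (n + 1).choose 4 = n.choose 3 + n.choose 4 := fun n => n.choose_succ_succ' 3
  rw [show k + 5 = k + 1 + 1 + 1 + 1 + 1 from rfl, show k + 4 = k + 1 + 1 + 1 + 1 from rfl] at h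
  -- Pascal's rule expands 5 C(k+4,4) - C(k+5,4) into 10 k + 20 C(k,2) + 15 C(k,3) + 4 C(k,4).
  simp only [c2, c3, c4, Nat.choose_one_right] at h ⊢
  omega

/-! ### Face moments as integrals over the corner simplex. -/

section FaceMoments

variable {d : ℕ} (w : Fin (d + 1) → R4)

/-- The vertices `w` as coordinate vectors. -/
def vertexCoords (a : Fin (d + 1)) (i : Fin 4) : ℝ := w a i

theorem eval_affineSubst (t : Fin d → ℝ) (i : Fin 4) :
    eval t (affineSubst (vertexCoords w) i) = param w t i := by
  simp [affineSubst, param, vertexCoords, edgeVec, mul_comm]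

theorem eval_aeval_affineSubst (t : Fin d → ℝ) (p : MvPolynomial (Fin 4) ℝ) :
    eval t (aeval (affineSubst (vertexCoords w)) p) = eval (fun i => param w t i) p := by
  have h : (aeval t).comp (aeval (affineSubst (vertexCoords w))) =
      aeval (R := ℝ) fun i => param w t i :=
    algHom_ext fun i => by
      simpa [aeval_eq_eval] using eval_affineSubst w t i
  simpa [aeval_eq_eval] using DFunLike.congr_fun h p

theorem eval_pull (E : PolyForm) (t : Fin d → ℝ) (j : Fin d) :
    eval t (pull (vertexCoords w) E j) = ⟪E.val (param w t), edgeVec w j⟫_ℝ := by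
  rw [pull_apply, map_sum]
  simp only [smul_eval, eval_aeval_affineSubst]
  simp [PiLp.inner_apply, PolyForm.val, vertexCoords, edgeVec]

theorem edgeVec_mem_vectorSpan (j : Fin d) : edgeVec w j ∈ vectorSpan ℝ (Set.range w) :=
  vsub_mem_vectorSpan ℝ (Set.mem_range_self _) (Set.mem_range_self _)

theorem inner_faceTrace (E : PolyForm) (x : R4) {y : R4} (hy : y ∈ vectorSpan ℝ (Set.range w)) :
    ⟪(faceTrace w E x : R4), y⟫_ℝ = ⟪E.val x, y⟫_ℝ :=
  Submodule.inner_orthogonalProjectionOnto_eq_of_mem_right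
    (⟨y, hy⟩ : vectorSpan ℝ (Set.range w)) (E.val x)

theorem inner_faceTrace_tangentField (E : PolyForm) (q : Fin d → MvPolynomial (Fin d) ℝ)
    (t : Fin d → ℝ) : ⟪(faceTrace w E (param w t) : R4), tangentField w q t⟫_ℝ =
      eval t (∑ i, pull (vertexCoords w) E i * q i) := by
  rw [inner_faceTrace, tangentField, inner_sum]
  · simp only [map_sum, map_mul, eval_pull, inner_smul_right, mul_comm]
  · exact sum_mem fun i _ => Submodule.smul_mem _ _ (edgeVec_mem_vectorSpan w i)

theorem faceMoment_eq (E : PolyForm) (q : Fin d → MvPolynomial (Fin d) ℝ) :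
    faceMoment w E q = √(Matrix.gram ℝ (edgeVec w)).det *
      cornerIntegral d (∑ i, pull (vertexCoords w) E i * q i) := by
  simp only [faceMoment, faceIntegral, inner_faceTrace_tangentField, cornerIntegral_apply]

theorem edgeMoment_eq (w : Fin 2 → R4) (E : PolyForm) (q : MvPolynomial (Fin 1) ℝ) :
    edgeMoment w E q = √(Matrix.gram ℝ (edgeVec w)).det * ‖w 1 - w 0‖⁻¹ *
      cornerIntegral 1 (pull (vertexCoords w) E 0 * q) := by
  have h : ∀ t, ⟪(faceTrace w E (param w t) : R4), unitTangent w⟫_ℝ * eval t q =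
      ‖w 1 - w 0‖⁻¹ * eval t (pull (vertexCoords w) E 0 * q) := fun t => by
    rw [unitTangent, inner_smul_right, map_mul, eval_pull, ← mul_assoc]
    congr 2
    exact inner_faceTrace w E _ (edgeVec_mem_vectorSpan w 0)
  simp only [edgeMoment, faceIntegral, h, cornerIntegral_apply]
  rw [MeasureTheory.integral_const_mul, mul_assoc]

theorem linearIndependent_edgeVec {w : Fin (d + 1) → R4} (hw : AffineIndependent ℝ w) :
    LinearIndependent ℝ (edgeVec w) :=
  ((affineIndependent_iff_linearIndependent_vsub ℝ w 0).1 hw).comp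
    (fun i : Fin d => (⟨i.succ, Fin.succ_ne_zero i⟩ : {x : Fin (d + 1) // x ≠ 0}))
    fun _ _ h => Fin.succ_injective _ (congrArg Subtype.val h)

theorem sqrt_det_gram_ne_zero {w : Fin (d + 1) → R4} (hw : AffineIndependent ℝ w) :
    √(Matrix.gram ℝ (edgeVec w)).det ≠ 0 :=
  (Real.sqrt_pos.2
    (Matrix.posDef_gram_of_linearIndependent (linearIndependent_edgeVec hw)).det_pos).ne'

end FaceMoments

/-! ### The pentatope and vanishing degrees of freedom. -/

section Pentatope

variable {v : Fin 5 → R4}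

/-- The linear part of the affine parametrization of a pentatope. -/
noncomputable def linParam (hv : AffineIndependent ℝ v) : (Fin 4 → ℝ) ≃ₗ[ℝ] R4 :=
  LinearEquiv.ofBijective (Fintype.linearCombination ℝ (edgeVec v)) <| by
    have h : Function.Injective (Fintype.linearCombination ℝ (edgeVec v)) :=
      (linearIndependent_edgeVec hv).fintypeLinearCombination_injective
    exact ⟨h, (LinearMap.injective_iff_surjective_of_finrank_eq_finrank (by simp)).1 h⟩

theorem param_eq (hv : AffineIndependent ℝ v) (t : Fin 4 → ℝ) :
    param v t = v 0 + linParam hv t :=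
  rfl

theorem param_surjective (hv : AffineIndependent ℝ v) : Function.Surjective (param v) := fun x =>
  ⟨(linParam hv).symm (x - v 0), by rw [param_eq hv]; simp⟩

theorem isOpenMap_param (hv : AffineIndependent ℝ v) : IsOpenMap (param v) :=
  (isOpenMap_add_left (v 0)).comp
    ((linParam hv).toLinearMap.isOpenMap_of_finiteDimensional (linParam hv).surjective)

theorem convex_corner (n : ℕ) : Convex ℝ (corner n) := by
  intro s hs t ht a b ha hb hab
  refine ⟨fun i => add_nonneg (mul_nonneg ha (hs.1 i)) (mul_nonneg hb (ht.1 i)), ?_⟩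
  simp only [Pi.add_apply, Pi.smul_apply, smul_eq_mul, Finset.sum_add_distrib, ← Finset.mul_sum]
  nlinarith [hs.2, ht.2]

theorem convexHull_subset_image_corner (hv : AffineIndependent ℝ v) :
    convexHull ℝ (Set.range v) ⊆ param v '' corner 4 := by
  refine convexHull_min ?_ ?_
  · rintro _ ⟨a, rfl⟩
    refine Fin.cases ⟨0, ⟨by simp, by simp⟩, by simp [param]⟩ (fun i => ?_) a
    refine ⟨Pi.single i 1, ⟨fun j => ?_, by simp⟩, ?_⟩
    · by_cases h : j = i <;> simp [h]
    · simp [param, Pi.single_apply, ite_smul, edgeVec]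
  · have h : param v '' corner 4 = (fun x => v 0 + x) '' (linParam hv '' corner 4) := by
      rw [Set.image_image]; rfl
    rw [h]
    exact ((convex_corner 4).linear_image (linParam hv).toLinearMap).translate (v 0)

theorem image_corner_subset_convexHull : param v '' corner 4 ⊆ convexHull ℝ (Set.range v) := by
  rintro _ ⟨t, ht, rfl⟩
  have h : param v t = ∑ a, (Fin.cons (1 - ∑ i, t i) t : Fin 5 → ℝ) a • v a := by
    rw [Fin.sum_univ_succ]
    simp only [Fin.cons_zero, Fin.cons_succ, param, edgeVec, smul_sub, Finset.sum_sub_distrib,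
      sub_smul, one_smul, Finset.sum_smul]
    abel
  rw [h]
  refine (convex_convexHull ℝ _).sum_mem (fun a _ => ?_) ?_
    fun a _ => subset_convexHull ℝ _ (Set.mem_range_self a)
  · exact Fin.cases (sub_nonneg.2 ht.2) ht.1 a
  · rw [Fin.sum_univ_succ]
    simp

/-- Affine coordinates as polynomials of degree one in x carry test fields from the corner simplex
to the pentatope without raising their degree. -/
theorem exists_inverse_affineSubst (hv : AffineIndependent ℝ v) :
    ∃ s : Fin 4 → MvPolynomial (Fin 4) ℝ, (∀ j, s j ∈ polyLE 4 1) ∧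
      ∀ t j, eval (fun i => param v t i) (s j) = t j := by
  refine ⟨fun j => C (-(linParam hv).symm (v 0) j) +
    ∑ l, (linParam hv).symm (EuclideanSpace.basisFun (Fin 4) ℝ l) j • X l, fun j => ?_,
    fun t j => ?_⟩
  · exact add_mem (polyLE_mono zero_le_one (C_mem_polyLE _ _))
      (sum_mem fun l _ => Submodule.smul_mem _ _ (X_mem_polyLE l))
  · have h : ∀ x : R4, ∑ l, (linParam hv).symm (EuclideanSpace.basisFun (Fin 4) ℝ l) j * x l =
        (linParam hv).symm x j := fun x => by
      conv_rhs => rw [← (EuclideanSpace.basisFun (Fin 4) ℝ).sum_repr x]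
      simp [mul_comm]
    simp only [map_add, map_sum, eval_C, smul_eval, eval_X, h]
    rw [param_eq hv, map_add, LinearEquiv.symm_apply_apply, Pi.add_apply]
    ring

theorem continuous_coords : Continuous fun (x : R4) (i : Fin 4) => x i :=
  PiLp.continuous_ofLp 2 _

theorem inner_val (E q : PolyForm) (x : R4) :
    ⟪E.val x, q.val x⟫_ℝ = eval (fun j => x j) (∑ i, E i * q i) := by
  simp [PiLp.inner_apply, PolyForm.val, mul_comm]

theorem isCompact_pentatope (v : Fin 5 → R4) : IsCompact (convexHull ℝ (Set.range v)) :=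
  (Set.finite_range v).isCompact_convexHull ℝ

/-- Integration of polynomials over a pentatope. -/
noncomputable def pentatopeIntegral (v : Fin 5 → R4) : MvPolynomial (Fin 4) ℝ →ₗ[ℝ] ℝ :=
  compactIntegral MeasureTheory.volume (isCompact_pentatope v) _ continuous_coords

theorem volumeMoment_eq (v : Fin 5 → R4) (E q : PolyForm) :
    volumeMoment v E q = pentatopeIntegral v (∑ i, E i * q i) := by
  simp only [volumeMoment, inner_val]
  rfl

theorem eq_zero_of_pull_eq_zero (hv : AffineIndependent ℝ v) {E : PolyForm}
    (h : pull (vertexCoords v) E = 0) : E = 0 := by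
  have h1 : ∀ x, E.val x = 0 := fun x => by
    obtain ⟨t, rfl⟩ := param_surjective hv x
    have h2 : ∀ y, ⟪E.val (param v t), y⟫_ℝ = 0 := fun y => by
      obtain ⟨c, rfl⟩ := (linParam hv).surjective y
      change ⟪_, ∑ i, c i • edgeVec v i⟫_ℝ = 0
      rw [inner_sum]
      refine Finset.sum_eq_zero fun j _ => ?_
      rw [inner_smul_right, ← eval_pull, h]
      simp
    exact inner_self_eq_zero.1 (h2 _)
  funext i
  refine MvPolynomial.funext fun x => ?_
  have := congrArg (fun y : R4 => y i) (h1 (WithLp.toLp 2 x))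
  simpa [PolyForm.val] using this

theorem eq_zero_of_volumeMoment (hv : AffineIndependent ℝ v) {k : ℤ} {E : PolyForm}
    (hE : E ∈ nedelec 4 k)
    (h : ∀ b : Fin 5, pull (vertexCoords (v ∘ b.succAbove)) E = 0)
    (hint : ∀ q : PolyForm, (∀ i, q i ∈ polyLE 4 (k - 4)) → volumeMoment v E q = 0) : E = 0 := by
  obtain ⟨R, hR, hER⟩ := exists_bubble_form_of_pull_eq_zero
    (pull_mem_nedelec (vertexCoords v) hE) fun b => (pull_comp_succAbove _ b E).symm.trans (h b)
  refine eq_zero_of_pull_eq_zero hv (eq_zero_of_sum_bubble_mul hER fun t ht => ?_)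
  obtain ⟨s, hs, hst⟩ := exists_inverse_affineSubst hv
  -- Pushing `R` forward along the edge vectors makes `E · q` at `param v t` equal to the
  -- nonnegative bubble sum at `t`. Positivity is then used on the pentatope itself, with no change
  -- of variables in the integral.
  set q : PolyForm := fun i => ∑ j, edgeVec v j i • aeval s (R j) with hq
  have hqdeg : ∀ i, q i ∈ polyLE 4 (k - 4) := fun i =>
    sum_mem fun j _ => Submodule.smul_mem _ _ (aeval_mem_polyLE hs (hR j))
  have hqval : ∀ t, q.val (param v t) = ∑ j, eval t (R j) • edgeVec v j := fun t => by
    have hsR : ∀ p, eval (fun i => param v t i) (aeval s p) = eval t p := fun p => by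
      have : (aeval fun i => param v t i).comp (aeval s) = aeval (R := ℝ) t :=
        algHom_ext fun i => by simpa [aeval_eq_eval] using hst t i
      simpa [aeval_eq_eval] using DFunLike.congr_fun this p
    ext i
    simp [-aeval_eq_bind₁, PolyForm.val, hq, hsR, mul_comm]
  have hval : ∀ t, ⟪E.val (param v t), q.val (param v t)⟫_ℝ =
      ∑ j, eval t (pull (vertexCoords v) E j) * eval t (R j) := fun t => by
    rw [hqval, inner_sum]
    simp only [inner_smul_right, eval_pull, mul_comm]
  rw [← hval]
  refine eq_zero_on_open_of_setIntegral_eq_zero MeasureTheory.volume (isCompact_pentatope v)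
    (isOpenMap_param hv _ (isOpen_openCorner 4))
    ((Set.image_mono (openCorner_subset_corner 4)).trans image_corner_subset_convexHull)
    (g := fun x => ⟪E.val x, q.val x⟫_ℝ) ?_ (fun x hx => ?_) (hint q hqdeg)
    (Set.mem_image_of_mem _ ht)
  · simp only [inner_val]
    exact (continuous_eval _).comp continuous_coords
  · obtain ⟨t, ht, rfl⟩ := convexHull_subset_image_corner hv hx
    rw [hval]
    exact sum_bubble_mul_nonneg hER ht

theorem eq_zero_of_dofsVanish (hv : AffineIndependent ℝ v) {k : ℕ} {E : PolyForm} (hE : E ∈ V1 k)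
    (h : DofsVanish v k E) : E = 0 := by
  rw [V1_eq_nedelec] at hE
  have hne : ∀ {d : ℕ} (f : FaceIdx d), √(Matrix.gram ℝ (edgeVec (v ∘ f))).det ≠ 0 := fun f =>
    sqrt_det_gram_ne_zero (hv.comp_embedding f.toEmbedding)
  have h1 : ∀ e : FaceIdx 1, pull (vertexCoords (v ∘ e)) E = 0 := fun e => by
    refine eq_zero_of_cornerIntegral_one (pull_mem_nedelec _ hE) fun q hq => ?_
    have h2 := h.edge e ⟨q, hq⟩
    rw [edgeMoment_eq] at h2
    refine (mul_eq_zero.1 h2).resolve_left (mul_ne_zero (hne e) (inv_ne_zero ?_))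
    rw [norm_ne_zero_iff, sub_ne_zero]
    exact (hv.injective.comp e.injective).ne one_ne_zero
  have h2 : ∀ f : FaceIdx 2, pull (vertexCoords (v ∘ f)) E = 0 := fun f => by
    refine eq_zero_of_cornerIntegral (pull_mem_nedelec _ hE) (fun b => ?_) fun q hq => ?_
    · rw [← pull_comp_succAbove]
      exact h1 ((Fin.succAboveOrderEmb b).trans f)
    · have h3 := h.face f fun i => ⟨q i, hq i⟩
      rw [faceMoment_eq] at h3
      exact (mul_eq_zero.1 h3).resolve_left (hne f)
  have h3 : ∀ f : FaceIdx 3, pull (vertexCoords (v ∘ f)) E = 0 := fun f => by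
    refine eq_zero_of_cornerIntegral (pull_mem_nedelec _ hE) (fun b => ?_) fun q hq => ?_
    · rw [← pull_comp_succAbove]
      exact h2 ((Fin.succAboveOrderEmb b).trans f)
    · have h4 := h.facet f fun i => ⟨q i, hq i⟩
      rw [faceMoment_eq] at h4
      exact (mul_eq_zero.1 h4).resolve_left (hne f)
  exact eq_zero_of_volumeMoment hv hE (fun b => h3 (Fin.succAboveOrderEmb b))
    fun q hq => h.volume fun i => ⟨q i, hq i⟩

end Pentatope

/-! ### The degrees of freedom as a linear bijection. -/

/-- The moments of polynomial vector fields against a space of test fields. -/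
noncomputable def fieldMoments {n : ℕ} (I : MvPolynomial (Fin n) ℝ →ₗ[ℝ] ℝ)
    (W : Submodule ℝ (MvPolynomial (Fin n) ℝ)) :
    (Fin n → MvPolynomial (Fin n) ℝ) →ₗ[ℝ] Module.Dual ℝ (Fin n → W) :=
  LinearMap.mk₂ ℝ (fun u q => I (∑ i, u i * q i))
    (fun u u' q => by simp [add_mul, Finset.sum_add_distrib])
    (fun c u q => by simp only [Pi.smul_apply, smul_mul_assoc, ← Finset.smul_sum, map_smul])
    (fun u q q' => by simp [mul_add, Finset.sum_add_distrib])
    (fun c u q => by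
      simp only [Pi.smul_apply, Submodule.coe_smul, mul_smul_comm, ← Finset.smul_sum, map_smul])

/-- The moments of polynomials in one variable against a space of test functions. -/
noncomputable def scalarMoments (I : MvPolynomial (Fin 1) ℝ →ₗ[ℝ] ℝ)
    (W : Submodule ℝ (MvPolynomial (Fin 1) ℝ)) :
    (Fin 1 → MvPolynomial (Fin 1) ℝ) →ₗ[ℝ] Module.Dual ℝ W :=
  LinearMap.mk₂ ℝ (fun u q => I (u 0 * q))
    (fun u u' q => by simp [add_mul])
    (fun c u q => by simp only [Pi.smul_apply, smul_mul_assoc, map_smul])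
    (fun u q q' => by simp [mul_add])
    (fun c u q => by simp only [Submodule.coe_smul, mul_smul_comm, map_smul])

/-- The degrees of freedom as a linear map. -/
noncomputable def dofMap (v : Fin 5 → R4) (k : ℕ) : PolyForm →ₗ[ℝ] DofSpace k :=
  (LinearMap.pi fun e : FaceIdx 1 => (√(Matrix.gram ℝ (edgeVec (v ∘ e))).det * ‖v (e 1) - v (e 0)‖⁻¹) •
    (scalarMoments (cornerIntegral 1) _ ∘ₗ pull (vertexCoords (v ∘ e)))).prod <|
  (LinearMap.pi fun f : FaceIdx 2 => √(Matrix.gram ℝ (edgeVec (v ∘ f))).det •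
    (fieldMoments (cornerIntegral 2) _ ∘ₗ pull (vertexCoords (v ∘ f)))).prod <|
  (LinearMap.pi fun f : FaceIdx 3 => √(Matrix.gram ℝ (edgeVec (v ∘ f))).det •
    (fieldMoments (cornerIntegral 3) _ ∘ₗ pull (vertexCoords (v ∘ f)))).prod <|
  fieldMoments (pentatopeIntegral v) _

theorem dofMap_edge (v : Fin 5 → R4) (k : ℕ) (E : PolyForm) (e : FaceIdx 1)
    (q : polyLE 1 ((k : ℤ) - 1)) : (dofMap v k E).1 e q = edgeMoment (v ∘ e) E q := by
  rw [edgeMoment_eq]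
  rfl

theorem dofMap_face (v : Fin 5 → R4) (k : ℕ) (E : PolyForm) (f : FaceIdx 2)
    (q : Fin 2 → polyLE 2 ((k : ℤ) - 2)) :
    (dofMap v k E).2.1 f q = faceMoment (v ∘ f) E fun i => q i := by
  rw [faceMoment_eq]
  rfl

theorem dofMap_facet (v : Fin 5 → R4) (k : ℕ) (E : PolyForm) (f : FaceIdx 3)
    (q : Fin 3 → polyLE 3 ((k : ℤ) - 3)) :
    (dofMap v k E).2.2.1 f q = faceMoment (v ∘ f) E fun i => q i := by
  rw [faceMoment_eq]
  rfl

theorem dofMap_volume (v : Fin 5 → R4) (k : ℕ) (E : PolyForm)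
    (q : Fin 4 → polyLE 4 ((k : ℤ) - 4)) :
    (dofMap v k E).2.2.2 q = volumeMoment v E fun i => q i := by
  rw [volumeMoment_eq]
  rfl

theorem hasDofs_iff (v : Fin 5 → R4) (k : ℕ) (E : PolyForm) (b : DofValues k) :
    HasDofs v k E b ↔ dofMap v k E = (b.edge, b.face, b.facet, b.volume) := by
  have h1 := dofMap_edge v k E
  have h2 := dofMap_face v k E
  have h3 := dofMap_facet v k E
  have h4 := dofMap_volume v k E
  generalize dofMap v k E = D at h1 h2 h3 h4 ⊢
  obtain ⟨D1, D2, D3, D4⟩ := D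
  simp only [Prod.mk.injEq]
  dsimp only at h1 h2 h3 h4
  constructor
  · rintro ⟨e, f, g, c⟩
    refine ⟨?_, ?_, ?_, ?_⟩
    · ext a q
      rw [h1, e]
    · funext a
      refine DFunLike.ext _ _ fun q => ?_
      rw [h2, f]
    · funext a
      refine DFunLike.ext _ _ fun q => ?_
      rw [h3, g]
    · refine DFunLike.ext _ _ fun q => ?_
      rw [h4, c]
  · rintro ⟨e, f, g, c⟩
    exact ⟨fun a q => by rw [← h1, e], fun a q => by rw [← h2, f], fun a q => by rw [← h3, g],
      fun q => by rw [← h4, c]⟩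

theorem dofsVanish_of_dofMap_eq_zero {v : Fin 5 → R4} {k : ℕ} {E : PolyForm}
    (h : dofMap v k E = 0) : DofsVanish v k E := by
  have := (hasDofs_iff v k E ⟨0, 0, 0, 0⟩).2 h
  exact ⟨this.edge, this.face, this.facet, this.volume⟩

theorem dofMap_bijective {v : Fin 5 → R4} (hv : AffineIndependent ℝ v) (k : ℕ) :
    Function.Bijective (dofMap v k ∘ₗ (V1 k).subtype) := by
  have hfin : Module.Finite ℝ (V1 k) := by rw [V1_eq_nedelec]; exact finite_nedelec 4 k
  have hinj : Function.Injective (dofMap v k ∘ₗ (V1 k).subtype) := by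
    rw [injective_iff_map_eq_zero]
    exact fun E hE => Subtype.ext (eq_zero_of_dofsVanish hv E.2 (dofsVanish_of_dofMap_eq_zero hE))
  exact ⟨hinj, (LinearMap.injective_iff_surjective_of_finrank_eq_finrank
    (le_antisymm (LinearMap.finrank_le_finrank_of_injective hinj)
      (finrank_dofSpace_le_finrank_V1 k))).1 hinj⟩

/-- On every non-degenerate pentatope, a shape function whose degrees of freedom all vanish is zero,
and the degrees of freedom are unisolvent: every choice of values is attained exactly once. -/
theorem mainTheorem1 (v : Fin 5 → R4) (hv : AffineIndependent ℝ v) (k : ℕ) :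
    (∀ E ∈ V1 k, DofsVanish v k E → E = 0) ∧
    (∀ b : DofValues k, ∃! E : PolyForm, E ∈ V1 k ∧ HasDofs v k E b) := by
  refine ⟨fun E hE h => eq_zero_of_dofsVanish hv hE h, fun b => ?_⟩
  simp only [hasDofs_iff]
  obtain ⟨E, hE⟩ := (dofMap_bijective hv k).2 (b.edge, b.face, b.facet, b.volume)
  exact ⟨E, ⟨E.2, hE⟩, fun F hF => congrArg Subtype.val
    ((dofMap_bijective hv k).1 (a₁ := ⟨F, hF.1⟩) (hF.2.trans hE.symm))⟩
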